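/- Let $\Gamma=(V,E)$ be a finite directed multigraph (loops and parallel edges allowed) whose edges are weighted by distinct indeterminates $x_e$, $e\in E$. For a vertex $v$ of a finite edge-weighted directed multigraph, let $A_v$ denote the sum, over all spanning trees $T$ directed towards $v$ (for every vertex $w$ there is a unique directed path from $w$ to $v$ in $T$), of the product of the weights of the edges of $T$. Let $k$ be a natural number and let $\pi\colon\tilde\Gamma\to\Gamma$ be a $k$-fold covering graph: a finite directed multigraph $\tilde\Gamma$, not necessarily connected, with a map $\pi$ sending vertices to vertices and edges to edges and preserving sources, targets and edge weights, such that every vertex and every edge of $\Gamma$ has exactly $k$ preimages, and such that for every vertex $\tilde u$ of $\tilde\Gamma$ the map $\pi$ restricts to a bijection from the edges leaving (respectively entering) $\tilde u$ to the edges leaving (respectively entering) $\pi(\tilde u)$. Then for every vertex $v$ of $\Gamma$ and every vertex $\tilde v$ of $\tilde\Gamma$ with $\pi(\tilde v)=v$ there is a homogeneous polynomial $P\in\mathbb Z[x_e : e\in E]$ such that $$A_{\tilde v}(\tilde\Gamma)=P\cdot A_v(\Gamma).$$ In particular, if $A_v(\Gamma)\neq 0$, the ratio $\frac{A_{\tilde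 v}(\tilde\Gamma)}{A_v(\Gamma)}$, taken in the field of fractions of $\mathbb Z[x_e : e\in E]$, is a homogeneous polynomial in the edge weights with integer coefficients. -/

import Mathlib

/-- An edge-weighted directed multigraph with vertex set `V`, edge set `E` and weights in `R`.
Loops and parallel edges are allowed. -/
structure WeightedMultidigraph (V E R : Type*) where
  /-- source of an edge -/
  src : E → V
  /-- target of an edge -/
  tgt : E → V
  /-- weight of an edge -/
  wt : E → R

namespace WeightedMultidigraph

variable {V E V' E' R : Type*}

/-- `Γ.IsDirectedPath u p v`: the list of edges `p` runs from `u` to `v` (each edge starts where the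
previous one ended). The empty list runs from `u` to `u`. -/
def IsDirectedPath (Γ : WeightedMultidigraph V E R) : V → List E → V → Prop
  | u, [], v => u = v
  | u, e :: p, v => Γ.src e = u ∧ Γ.IsDirectedPath (Γ.tgt e) p v

/-- A set `T` of edges is an arborescence rooted at `v` if for every vertex `w` there is exactly
one directed path from `w` to `v` with all edges in `T`. Since paths are allowed to revisit
vertices here, uniqueness says that `T` has no directed cycle and no edge leaving `v`, so that
`T` is a spanning tree directed towards `v`. -/
def IsArborescence (Γ : WeightedMultidigraph V E R) (v : V) (T : Finset E) : Prop :=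
  ∀ w : V, ∃! p : List E, (∀ e ∈ p, e ∈ T) ∧ Γ.IsDirectedPath w p v

open Classical in
/-- `A_v(Γ)`: the sum, over all arborescences `T` of `Γ` rooted at `v`, of the product of the
weights of the edges of `T`. -/
noncomputable def arborescenceSum [Fintype E] [CommSemiring R]
    (Γ : WeightedMultidigraph V E R) (v : V) : R :=
  ∑ T : Finset E with Γ.IsArborescence v T, ∏ e ∈ T, Γ.wt e

/-- A `k`-fold covering map from the weighted multidigraph `Γ'` onto `Γ`. -/
structure KFoldCover (k : ℕ) (Γ' : WeightedMultidigraph V' E' R)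
    (Γ : WeightedMultidigraph V E R) where
  /-- the projection on vertices -/
  onV : V' → V
  /-- the projection on edges -/
  onE : E' → E
  /-- the projection preserves sources -/
  src_onE : ∀ e, Γ.src (onE e) = onV (Γ'.src e)
  /-- the projection preserves targets -/
  tgt_onE : ∀ e, Γ.tgt (onE e) = onV (Γ'.tgt e)
  /-- every vertex has exactly `k` lifts -/
  card_fiber_onV : ∀ v, {v' | onV v' = v}.encard = k
  /-- every edge has exactly `k` lifts -/
  card_fiber_onE : ∀ e, {e' | onE e' = e}.encard = k
  /-- a lifted edge has the weight of its base edge -/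
  wt_onE : ∀ e, Γ'.wt e = Γ.wt (onE e)
  /-- local homeomorphism: the outgoing edges at `v'` correspond to those at its image -/
  bijOn_out : ∀ v', Set.BijOn onE {e' | Γ'.src e' = v'} {e | Γ.src e = onV v'}
  /-- local homeomorphism: the incoming edges at `v'` correspond to those at its image -/
  bijOn_in : ∀ v', Set.BijOn onE {e' | Γ'.tgt e' = v'} {e | Γ.tgt e = onV v'}

end WeightedMultidigraph

/-! By the matrix-tree theorem (`det_laplacian_updateRow_self`) the sums `A_w` are cofactors of the
Laplacian `L`, and the vector `A` lies in its left kernel. On functions pulled back from `Γ`, the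
Laplacian `L'` of the cover acts as `L`.

Let `c` be the indicator of the fibre over `v`. Then `L' + c δ_{v'}ᵀ` acts on pullbacks as `L + δ_v
δ_vᵀ`, so the determinant of the second divides that of the first (`det_dvd_det_of_mulVec_comp`).
These determinants are `A_v` and the sum of `A'_w` over the fibre (`det_laplacian_add_vecMulVec`,
used when `A'_{v'} ≠ 0`).

When `A_v ≠ 0`, all `A'_w` in the fibre agree: `A'` and the pullback of `A` both lie in the left
kernel of `L'`, which is a line unless `A'` vanishes on the fibre (`arborescenceSum_eq_of_onV_eq`).
Hence `A_v` divides `k A'_{v'}`. The factor `k` cancels because `A_v` takes the value 1 at an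
integer point, so no nonunit integer divides it. -/

namespace WeightedMultidigraph

variable {V E R : Type*}

/-! ### Combinatorics of arborescences -/

section Arborescence

variable {Γ : WeightedMultidigraph V E R} {v : V} {T : Finset E}

lemma IsDirectedPath.exists_cons {u v : V} {p : List E} (hp : Γ.IsDirectedPath u p v)
    (huv : u ≠ v) : ∃ e q, p = e :: q ∧ Γ.src e = u ∧ Γ.IsDirectedPath (Γ.tgt e) q v := by
  cases p with
  | nil => exact absurd hp huv
  | cons e q => exact ⟨e, q, rfl, hp.1, hp.2⟩

lemma IsArborescence.src_ne (h : Γ.IsArborescence v T) {e : E} (he : e ∈ T) : Γ.src e ≠ v := by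
  intro hev
  obtain ⟨p, ⟨hpT, hp⟩, -⟩ := h (Γ.tgt e)
  have := (h v).unique (y₁ := []) (y₂ := e :: p) ⟨by simp, rfl⟩
    ⟨by simpa using ⟨he, hpT⟩, hev, hp⟩
  simp at this

lemma IsArborescence.injOn_src (h : Γ.IsArborescence v T) : Set.InjOn Γ.src (T : Set E) := by
  intro e he e' he' hee'
  obtain ⟨p, ⟨hpT, hp⟩, -⟩ := h (Γ.tgt e)
  obtain ⟨q, ⟨hqT, hq⟩, -⟩ := h (Γ.tgt e')
  have := (h (Γ.src e)).unique (y₁ := e :: p) (y₂ := e' :: q)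
    ⟨by simpa using ⟨he, hpT⟩, rfl, hp⟩ ⟨by simpa using ⟨he', hqT⟩, hee'.symm, hq⟩
  simp_all

lemma IsArborescence.exists_src_eq (h : Γ.IsArborescence v T) {u : V} (hu : u ≠ v) :
    ∃ e ∈ T, Γ.src e = u := by
  obtain ⟨p, ⟨hpT, hp⟩, -⟩ := h u
  obtain ⟨e, q, rfl, he, -⟩ := hp.exists_cons hu
  exact ⟨e, hpT e (by simp), he⟩

lemma IsArborescence.card_add_one [Fintype V] (h : Γ.IsArborescence v T) :
    T.card + 1 = Fintype.card V := by
  classical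
  have : T.image Γ.src = Finset.univ.erase v := by
    ext u
    simp only [Finset.mem_image, Finset.mem_erase, Finset.mem_univ, and_true]
    exact ⟨fun ⟨e, he, hu⟩ => hu ▸ h.src_ne he, h.exists_src_eq⟩
  rw [← Finset.card_image_of_injOn h.injOn_src, this, Finset.card_erase_add_one (Finset.mem_univ v),
    Finset.card_univ]

/-- With at most one edge out of each vertex and none out of the root, a path to the root is forced
edge by edge, so uniqueness is automatic. -/
lemma isArborescence_of_exists_path (hv : ∀ e ∈ T, Γ.src e ≠ v)
    (hinj : Set.InjOn Γ.src (T : Set E))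
    (hex : ∀ w, ∃ p : List E, (∀ e ∈ p, e ∈ T) ∧ Γ.IsDirectedPath w p v) :
    Γ.IsArborescence v T := by
  have key : ∀ (p q : List E) (w : V), (∀ e ∈ p, e ∈ T) → Γ.IsDirectedPath w p v →
      (∀ e ∈ q, e ∈ T) → Γ.IsDirectedPath w q v → p = q := by
    intro p
    induction p with
    | nil =>
      rintro (_ | ⟨e, q⟩) w - hp hqT hq
      · rfl
      · exact absurd (hq.1.trans hp) (hv e (hqT e (by simp)))
    | cons e p ih =>
      rintro (_ | ⟨e', q⟩) w hpT hp hqT hq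
      · exact absurd (hp.1.trans hq) (hv e (hpT e (by simp)))
      · obtain rfl : e = e' := hinj (hpT e (by simp)) (hqT e' (by simp)) (hp.1.trans hq.1.symm)
        rw [ih q (Γ.tgt e) (fun e he => hpT e (by simp [he])) hp.2
          (fun e he => hqT e (by simp [he])) hq.2]
  intro w
  obtain ⟨p, hpT, hp⟩ := hex w
  exact ⟨p, ⟨hpT, hp⟩, fun q hq => key q p w hq.1 hq.2 hpT hp⟩

end Arborescence

/-! ### The matrix-tree theorem and the left kernel of the Laplacian -/

section MatrixTree

variable [DecidableEq V] [Fintype E]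

/-- The outgoing Laplacian matrix: the row of `u` is the sum of `wt e • (δ_u - δ_{tgt e})` over the
edges `e` leaving `u`. -/
def laplacian [CommRing R] (Γ : WeightedMultidigraph V E R) : Matrix V V R :=
  Matrix.of fun u => ∑ e with Γ.src e = u, Γ.wt e • (Pi.single u 1 - Pi.single (Γ.tgt e) 1)

lemma laplacian_row [CommRing R] (Γ : WeightedMultidigraph V E R) (u : V) :
    Γ.laplacian u = ∑ e with Γ.src e = u, Γ.wt e • (Pi.single u 1 - Pi.single (Γ.tgt e) 1) := rfl

/-- The edges selected by a partial choice of one edge at each vertex. -/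
def chosenEdges [DecidableEq E] (Γ : WeightedMultidigraph V E R) (r : V → Option E) : Finset E :=
  {e | r (Γ.src e) = some e}

/-- The admissible choices at `u` of an outgoing edge, no edge being chosen at the root `v`. -/
def edgeChoices (Γ : WeightedMultidigraph V E R) (v u : V) : Finset (Option E) :=
  if u = v then {none} else ({e | Γ.src e = u} : Finset E).map Function.Embedding.some

/-- The row of the reduced Laplacian contributed by a choice at `u`, without its weight. -/
def choiceRow [CommRing R] (Γ : WeightedMultidigraph V E R) (u : V) (o : Option E) : V → R :=
  o.elim (Pi.single u 1) fun e => Pi.single u 1 - Pi.single (Γ.tgt e) 1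

lemma mem_edgeChoices_self (Γ : WeightedMultidigraph V E R) {v : V} {o : Option E} :
    o ∈ Γ.edgeChoices v v ↔ o = none := by
  simp [edgeChoices]

lemma mem_edgeChoices_of_ne (Γ : WeightedMultidigraph V E R) {u v : V} (h : u ≠ v)
    {o : Option E} : o ∈ Γ.edgeChoices v u ↔ ∃ e, Γ.src e = u ∧ o = some e := by
  simp [edgeChoices, h, eq_comm]

omit [DecidableEq V] in
lemma mem_chosenEdges [DecidableEq E] (Γ : WeightedMultidigraph V E R) {r : V → Option E} {e : E} :
    e ∈ Γ.chosenEdges r ↔ r (Γ.src e) = some e := by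
  simp [chosenEdges]

section Choice

variable [DecidableEq E] (Γ : WeightedMultidigraph V E R) {v : V} {r : V → Option E}

lemma src_ne_of_mem_chosenEdges (hr : ∀ u, r u ∈ Γ.edgeChoices v u) {e : E}
    (he : e ∈ Γ.chosenEdges r) : Γ.src e ≠ v := by
  rintro rfl
  have := Γ.mem_edgeChoices_self.1 (hr (Γ.src e))
  rw [Γ.mem_chosenEdges, this] at he
  cases he

omit [DecidableEq V] in
lemma injOn_src_chosenEdges : Set.InjOn Γ.src (Γ.chosenEdges r : Set E) := by
  intro e he e' he' hee'
  rw [Finset.mem_coe, Γ.mem_chosenEdges] at he he'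
  exact Option.some_injective _ (by rw [← he, ← he', hee'])

lemma exists_choice_eq (hr : ∀ u, r u ∈ Γ.edgeChoices v u) {u : V} (hu : u ≠ v) :
    ∃ e ∈ Γ.chosenEdges r, Γ.src e = u ∧ r u = some e := by
  obtain ⟨e, he, hre⟩ := (Γ.mem_edgeChoices_of_ne hu).1 (hr u)
  exact ⟨e, Γ.mem_chosenEdges.2 (he ▸ hre), he, hre⟩

variable {Γ} in
lemma exists_chosenEdges_eq {T : Finset E}
    (h : Γ.IsArborescence v T) :
    ∃ r : V → Option E, (∀ u, r u ∈ Γ.edgeChoices v u) ∧ Γ.chosenEdges r = T := by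
  choose f hfT hf using fun u (hu : u ≠ v) => h.exists_src_eq hu
  refine ⟨fun u => if hu : u = v then none else some (f u hu), fun u => ?_, ?_⟩
  · by_cases hu : u = v
    · subst hu
      simp [mem_edgeChoices_self]
    · simp [mem_edgeChoices_of_ne, hu, hf u hu]
  · ext e
    rw [mem_chosenEdges]
    constructor
    · intro he
      split_ifs at he with hev
      exact Option.some_injective _ he ▸ hfT _ hev
    · intro he
      have hev := h.src_ne he
      rw [dif_neg hev, h.injOn_src (hfT _ hev) he (hf _ hev)]

variable [Fintype V]

lemma prod_chosenEdges [CommRing R] (hr : ∀ u, r u ∈ Γ.edgeChoices v u) :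
    ∏ u, (r u).elim 1 Γ.wt = ∏ e ∈ Γ.chosenEdges r, Γ.wt e := by
  rw [← Finset.prod_fiberwise (s := Γ.chosenEdges r) (g := Γ.src)]
  refine Finset.prod_congr rfl fun u _ => ?_
  by_cases hu : u = v
  · subst hu
    rw [Γ.mem_edgeChoices_self.1 (hr u), Finset.filter_false_of_mem, Finset.prod_empty]
    · rfl
    · exact fun e he => Γ.src_ne_of_mem_chosenEdges hr he
  · obtain ⟨e, he, heu, hre⟩ := Γ.exists_choice_eq hr hu
    have : {e ∈ Γ.chosenEdges r | Γ.src e = u} = {e} := by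
      ext e'
      simp only [Finset.mem_filter, Finset.mem_singleton]
      refine ⟨fun h => Γ.injOn_src_chosenEdges h.1 he (h.2.trans heu.symm), ?_⟩
      rintro rfl
      exact ⟨he, heu⟩
    rw [this, Finset.prod_singleton, hre]
    rfl

/-- Each chosen edge decreases the distance to the root, so ordering vertices by depth makes the
matrix triangular with identity diagonal blocks. -/
lemma det_choiceRow_of_isArborescence [CommRing R] (hr : ∀ u, r u ∈ Γ.edgeChoices v u)
    (h : Γ.IsArborescence v (Γ.chosenEdges r)) :
    (Matrix.of fun u => Γ.choiceRow u (r u)).det = 1 := by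
  choose p hp using fun w => (h w).exists
  let depth : V → ℕ := fun w => (p w).length
  have hdepth : ∀ u e, r u = some e → depth (Γ.tgt e) < depth u := by
    intro u e hre
    have hu : u ≠ v := by
      rintro rfl
      rw [Γ.mem_edgeChoices_self.1 (hr u)] at hre
      cases hre
    obtain ⟨e', he', heu, hre'⟩ := Γ.exists_choice_eq hr hu
    obtain rfl : e = e' := Option.some_injective _ (hre.symm.trans hre')
    have : p u = e :: p (Γ.tgt e) := (h u).unique (hp u)
      ⟨by simpa using ⟨he', (hp (Γ.tgt e)).1⟩, heu, (hp (Γ.tgt e)).2⟩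
    simp [depth, this]
  have hentry : ∀ u w, depth u ≤ depth w →
      Γ.choiceRow u (r u) w = (1 : Matrix V V R) u w := by
    intro u w huw
    rw [Matrix.one_eq_pi_single]
    cases hre : r u with
    | none => rfl
    | some e =>
      have : w ≠ Γ.tgt e := by
        rintro rfl
        exact absurd (hdepth u e hre) (not_lt.2 huw)
      simp [choiceRow, this]
  have htri : (Matrix.of fun u => Γ.choiceRow u (r u)).BlockTriangular
      (OrderDual.toDual ∘ depth) := by
    intro u w huw
    have huw' : depth u < depth w := huw
    rw [Matrix.of_apply, hentry u w huw'.le, Matrix.one_apply_ne]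
    rintro rfl
    exact lt_irrefl _ huw'
  rw [htri.det]
  refine Finset.prod_eq_one fun a _ => ?_
  rw [← Matrix.det_one (R := R) (n := {u // (OrderDual.toDual ∘ depth) u = a})]
  congr 1
  ext ⟨u, hu⟩ ⟨w, hw⟩
  rw [Matrix.toSquareBlock_def, Matrix.of_apply, Matrix.of_apply,
    hentry u w (OrderDual.toDual.injective (hu.trans hw.symm)).le]
  simp [Matrix.one_apply]

/-- The indicator of the vertices that cannot reach the root is a nonzero kernel vector, since it is
constant along chosen edges and vanishes at the root. -/
lemma det_choiceRow_of_not_isArborescence [CommRing R] [IsDomain R]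
    (hr : ∀ u, r u ∈ Γ.edgeChoices v u) (h : ¬ Γ.IsArborescence v (Γ.chosenEdges r)) :
    (Matrix.of fun u => Γ.choiceRow u (r u)).det = 0 := by
  classical
  let reaches : V → Prop := fun w =>
    ∃ p : List E, (∀ e ∈ p, e ∈ Γ.chosenEdges r) ∧ Γ.IsDirectedPath w p v
  have hv : reaches v := ⟨[], by simp, rfl⟩
  have hstep : ∀ u e, u ≠ v → r u = some e → (reaches u ↔ reaches (Γ.tgt e)) := by
    intro u e hu hre
    obtain ⟨e', he', heu, hre'⟩ := Γ.exists_choice_eq hr hu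
    obtain rfl : e = e' := Option.some_injective _ (hre.symm.trans hre')
    constructor
    · rintro ⟨p, hpT, hp⟩
      obtain ⟨e', q, rfl, he'u, hq⟩ := hp.exists_cons hu
      obtain rfl : e' = e := Γ.injOn_src_chosenEdges (hpT e' (by simp)) he' (he'u.trans heu.symm)
      exact ⟨q, fun e he => hpT e (by simp [he]), hq⟩
    · rintro ⟨p, hpT, hp⟩
      exact ⟨e :: p, by simpa using ⟨he', hpT⟩, heu, hp⟩
  obtain ⟨w, hw⟩ : ∃ w, ¬ reaches w := by
    by_contra! hall
    exact h (isArborescence_of_exists_path (fun e he => Γ.src_ne_of_mem_chosenEdges hr he)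
      Γ.injOn_src_chosenEdges hall)
  rw [← Matrix.exists_mulVec_eq_zero_iff]
  refine ⟨fun u => if reaches u then 0 else 1, fun h0 => ?_, ?_⟩
  · simpa [hw] using congrFun h0 w
  · ext u
    by_cases hu : u = v
    · subst hu
      simp [Matrix.mulVec, choiceRow, Γ.mem_edgeChoices_self.1 (hr u), hv]
    · obtain ⟨e, he, heu, hre⟩ := Γ.exists_choice_eq hr hu
      have hrow : Γ.choiceRow u (r u) = Pi.single u 1 - Pi.single (Γ.tgt e) 1 := by rw [hre]; rfl
      simp only [Matrix.mulVec, Matrix.of_apply, hrow, sub_dotProduct, single_dotProduct,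
        hstep u e hu hre, sub_self, Pi.zero_apply]

end Choice

lemma laplacian_updateRow_eq_sum [CommRing R] (Γ : WeightedMultidigraph V E R) (v u : V) :
    Γ.laplacian.updateRow v (Pi.single v 1) u =
      ∑ o ∈ Γ.edgeChoices v u, o.elim (1 : R) Γ.wt • Γ.choiceRow u o := by
  by_cases hu : u = v
  · subst hu
    simp [edgeChoices, choiceRow]
  · simp [edgeChoices, hu, choiceRow, laplacian_row]

variable [Fintype V]

lemma laplacian_mulVec [CommRing R] (Γ : WeightedMultidigraph V E R) (f : V → R) (u : V) :
    (Γ.laplacian.mulVec f) u = ∑ e with Γ.src e = u, Γ.wt e * (f u - f (Γ.tgt e)) := by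
  simp only [Matrix.mulVec, laplacian_row, sum_dotProduct, smul_dotProduct, sub_dotProduct,
    single_dotProduct, one_mul, smul_eq_mul]

lemma vecMul_laplacian [CommRing R] (Γ : WeightedMultidigraph V E R) (a : V → R) (z : V) :
    (Matrix.vecMul a Γ.laplacian) z =
      (∑ e with Γ.src e = z, Γ.wt e) * a z - ∑ e with Γ.tgt e = z, Γ.wt e * a (Γ.src e) := by
  have h : (Matrix.vecMul a Γ.laplacian) z =
      ∑ e, a (Γ.src e) * (Γ.wt e * ((Pi.single (Γ.src e) 1 : V → R) z - (Pi.single (Γ.tgt e) 1 : V → R) z)) := by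
    rw [← Finset.sum_fiberwise (g := Γ.src)]
    simp only [Matrix.vecMul, dotProduct, laplacian_row, Finset.sum_apply, Pi.smul_apply,
      Pi.sub_apply, smul_eq_mul, Finset.mul_sum]
    refine Finset.sum_congr rfl fun u _ => Finset.sum_congr rfl fun e he => ?_
    rw [(Finset.mem_filter.1 he).2]
  rw [h, Finset.sum_filter, Finset.sum_filter, Finset.sum_mul, ← Finset.sum_sub_distrib]
  refine Finset.sum_congr rfl fun e _ => ?_
  simp only [Pi.single_apply, eq_comm (a := z)]
  split_ifs with h1 h2 <;> simp_all <;> ring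

lemma laplacian_mulVec_one [CommRing R] (Γ : WeightedMultidigraph V E R) :
    Γ.laplacian.mulVec 1 = 0 := by
  ext u
  simp [laplacian_mulVec]

/-- **Matrix-tree theorem** for directed multigraphs: the arborescence sum at `v` is the principal
cofactor of the Laplacian at `v`. -/
theorem det_laplacian_updateRow_self [CommRing R] [IsDomain R] (Γ : WeightedMultidigraph V E R)
    (v : V) : (Γ.laplacian.updateRow v (Pi.single v 1)).det = Γ.arborescenceSum v := by
  classical
  have hsum : (Γ.laplacian.updateRow v (Pi.single v 1)).det =
      ∑ r ∈ Fintype.piFinset (Γ.edgeChoices v),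
        Matrix.detRowAlternating fun u => (r u).elim (1 : R) Γ.wt • Γ.choiceRow u (r u) := by
    -- Each row is a sum over the edges leaving its vertex; multilinearity turns the determinant
    -- into a sum over choices of one edge per non-root vertex.
    have h := (Matrix.detRowAlternating (n := V) (R := R)).toMultilinearMap.map_sum_finset
      (fun u (o : Option E) => o.elim (1 : R) Γ.wt • Γ.choiceRow u o) (Γ.edgeChoices v)
    simp only [← laplacian_updateRow_eq_sum] at h
    exact h
  have hterm : ∀ r ∈ Fintype.piFinset (Γ.edgeChoices v),
      Matrix.detRowAlternating (fun u => (r u).elim (1 : R) Γ.wt • Γ.choiceRow u (r u)) =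
        if Γ.IsArborescence v (Γ.chosenEdges r) then ∏ e ∈ Γ.chosenEdges r, Γ.wt e else 0 := by
    intro r hr
    rw [Fintype.mem_piFinset] at hr
    have h := (Matrix.detRowAlternating (n := V) (R := R)).toMultilinearMap.map_smul_univ
      (fun u => (r u).elim (1 : R) Γ.wt) fun u => Γ.choiceRow u (r u)
    refine h.trans ?_
    change _ * (Matrix.of fun u => Γ.choiceRow u (r u)).det = _
    rw [Γ.prod_chosenEdges hr]
    split_ifs with harb
    · rw [Γ.det_choiceRow_of_isArborescence hr harb, mul_one]
    · rw [Γ.det_choiceRow_of_not_isArborescence hr harb, mul_zero]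
  rw [hsum, Finset.sum_congr rfl hterm, ← Finset.sum_filter, arborescenceSum]
  refine Finset.sum_nbij Γ.chosenEdges (fun r hr => ?_) ?_ (fun T hT => ?_) fun _ _ => rfl
  · simpa using (Finset.mem_filter.1 hr).2
  · intro r hr r' hr' heq
    simp only [Finset.coe_filter, Fintype.mem_piFinset, Set.mem_ofPred_eq] at hr hr'
    funext u
    by_cases hu : u = v
    · subst hu
      rw [Γ.mem_edgeChoices_self.1 (hr.1 u), Γ.mem_edgeChoices_self.1 (hr'.1 u)]
    · obtain ⟨e, he, rfl, hre⟩ := Γ.exists_choice_eq hr.1 hu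
      rw [heq, mem_chosenEdges] at he
      rw [hre, he]
  · have hT' : Γ.IsArborescence v T := by simpa using hT
    obtain ⟨r, hr, rfl⟩ := exists_chosenEdges_eq hT'
    exact ⟨r, by simpa [hT'] using hr, rfl⟩

lemma det_laplacian [CommRing R] [IsDomain R] [Nonempty V] (Γ : WeightedMultidigraph V E R) :
    Γ.laplacian.det = 0 :=
  Matrix.exists_mulVec_eq_zero_iff.1 ⟨1, one_ne_zero, Γ.laplacian_mulVec_one⟩

/-- Independence of `u`: with row `v` replaced by `δ_u - δ_v`, every row still sums to zero, so the
determinant vanishes. -/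
lemma adjugate_laplacian [CommRing R] [IsDomain R] (Γ : WeightedMultidigraph V E R) (u v : V) :
    Γ.laplacian.adjugate u v = Γ.arborescenceSum v := by
  rw [Matrix.adjugate_apply, ← Γ.det_laplacian_updateRow_self v, ← sub_eq_zero]
  have h : (Γ.laplacian.updateRow v (Pi.single u 1 - Pi.single v 1)).det = 0 := by
    refine Matrix.exists_mulVec_eq_zero_iff.1 ⟨1, ?_, ?_⟩
    · exact fun h => one_ne_zero (congrFun h v)
    · ext w
      by_cases hw : w = v
      · subst hw
        simp only [Matrix.mulVec, Matrix.updateRow_self, sub_dotProduct, single_dotProduct,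
          Pi.one_apply, sub_self, Pi.zero_apply]
      · rw [Matrix.mulVec, Matrix.updateRow_ne hw]
        exact congrFun Γ.laplacian_mulVec_one w
  rw [← h, sub_eq_add_neg (Pi.single u 1), Matrix.det_updateRow_add, ← neg_one_smul R (Pi.single v 1),
    Matrix.det_updateRow_smul, neg_one_mul, sub_eq_add_neg]

lemma vecMul_arborescenceSum [CommRing R] [IsDomain R] (Γ : WeightedMultidigraph V E R) :
    Matrix.vecMul Γ.arborescenceSum Γ.laplacian = 0 := by
  rcases isEmpty_or_nonempty V with hV | ⟨⟨v⟩⟩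
  · exact Subsingleton.elim _ _
  · have h : Γ.laplacian.adjugate v = Γ.arborescenceSum := funext fun w => Γ.adjugate_laplacian v w
    ext w
    have hV : Nonempty V := ⟨v⟩
    have := congrFun (congrFun (Γ.laplacian.adjugate_mul) v) w
    rw [Γ.det_laplacian, zero_smul, Matrix.mul_apply] at this
    rw [← h]
    exact this

end MatrixTree
-- Linear algebra: left kernels and determinants along a surjection
section CommonKernel

variable {n : Type*} [Fintype n] [DecidableEq n] [CommRing R] [IsDomain R]

/-- Off the zero locus of an adjugate row, the left kernel of a matrix is spanned by that row. -/
lemma adjugate_mul_eq_of_vecMul_eq_zero {M : Matrix n n R} {a b : n → R}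
    (ha : Matrix.vecMul a M = 0) (hb : Matrix.vecMul b M = 0) {i j l : n}
    (hadj : M.adjugate l j ≠ 0) : a j * b i = a i * b j := by
  -- This combination has coordinate zero at `j`, so it does not see row `j`.
  have hc : Matrix.vecMul (a j • b - b j • a) (M.updateRow j (Pi.single l 1)) = 0 := by
    have h0 : Matrix.vecMul (a j • b - b j • a) M = 0 := by
      rw [Matrix.sub_vecMul, Matrix.smul_vecMul, Matrix.smul_vecMul, ha, hb]
      simp
    rw [← h0]
    ext z
    refine Finset.sum_congr rfl fun w _ => ?_
    by_cases hw : w = j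
    · subst hw
      simp [mul_comm]
    · simp [Matrix.updateRow_ne hw]
  have hzero : a j • b - b j • a = 0 := by
    by_contra hne
    rw [Matrix.adjugate_apply] at hadj
    exact hadj (Matrix.exists_vecMul_eq_zero_iff.1 ⟨_, hne, hc⟩)
  have := congrFun hzero i
  simp only [Pi.sub_apply, Pi.smul_apply, smul_eq_mul, Pi.zero_apply] at this
  linear_combination this

end CommonKernel

/-- If `N` restricts to `M` on the vectors pulled back along a surjection, then
`det M` divides `det N`. -/
lemma det_dvd_det_of_mulVec_comp {m n : Type*} [Fintype m] [DecidableEq m] [Fintype n]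
    [DecidableEq n] [CommRing R] {M : Matrix m m R} {N : Matrix n n R} {f : n → m}
    (hf : Function.Surjective f) (h : ∀ g : m → R, N.mulVec (g ∘ f) = M.mulVec g ∘ f) :
    M.det ∣ N.det := by
  classical
  obtain ⟨s, hs⟩ := hf.hasRightInverse
  -- Index `n` by one representative per fibre, followed by the remaining points; `Q` records the
  -- fibres of the latter.
  let e : m ⊕ ↥(Set.range s)ᶜ ≃ n :=
    (Equiv.sumCongr (Equiv.ofInjective s hs.injective) (Equiv.refl _)).trans
      (Equiv.Set.sumCompl (Set.range s))
  have hel : ∀ u, e (Sum.inl u) = s u := fun u => rfl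
  let N' : Matrix (m ⊕ ↥(Set.range s)ᶜ) (m ⊕ ↥(Set.range s)ᶜ) R := N.submatrix e e
  let Q : Matrix ↥(Set.range s)ᶜ m R := Matrix.of fun j u => if f j = u then 1 else 0
  have hentry : ∀ i u, N' i (Sum.inl u) + ∑ j, N' i (Sum.inr j) * Q j u = M (f (e i)) u := by
    intro i u
    have h1 := congrFun (h (Pi.single u 1)) (e i)
    rw [Matrix.mulVec, dotProduct, ← e.sum_comp, Fintype.sum_sum_type] at h1
    simp only [Function.comp_apply, hel, hs _, Matrix.mulVec_single_one, Matrix.col_apply] at h1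
    rw [← h1]
    simp only [Pi.single_apply, mul_ite, mul_one, mul_zero, Finset.sum_ite_eq', Finset.mem_univ,
      if_true, Q, Matrix.of_apply]
    rfl
  have hA : N'.toBlocks₁₁ + N'.toBlocks₁₂ * Q = M := by
    ext u u'
    have := hentry (Sum.inl u) u'
    rwa [hel, hs] at this
  have hC : N'.toBlocks₂₁ + N'.toBlocks₂₂ * Q = Q * M := by
    ext j u'
    refine (hentry (Sum.inr j) u').trans ?_
    rw [Matrix.mul_apply]
    simp only [Q, Matrix.of_apply, ite_mul, one_mul, zero_mul, Finset.sum_ite_eq, Finset.mem_univ,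
      if_true]
    rfl
  -- The right factor adds the columns of each fibre into that of its representative; the left
  -- factor subtracts the representative's row from the others.
  have hprod : Matrix.fromBlocks 1 0 (-Q) 1 * (N' * Matrix.fromBlocks 1 0 Q 1) =
      Matrix.fromBlocks M N'.toBlocks₁₂ 0 (N'.toBlocks₂₂ - Q * N'.toBlocks₁₂) := by
    conv_lhs => rw [← Matrix.fromBlocks_toBlocks N']
    rw [Matrix.fromBlocks_multiply, Matrix.fromBlocks_multiply]
    simp only [Matrix.mul_one, Matrix.mul_zero, zero_add, hA, hC, Matrix.one_mul, Matrix.zero_mul,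
      add_zero, Matrix.neg_mul, neg_add_cancel]
    rw [neg_add_eq_sub]
  have hdet := congrArg Matrix.det hprod
  rw [Matrix.det_mul, Matrix.det_mul, Matrix.det_fromBlocks_zero₁₂, Matrix.det_fromBlocks_zero₁₂,
    Matrix.det_fromBlocks_zero₂₁, Matrix.det_one, Matrix.det_one, one_mul, one_mul, mul_one,
    Matrix.det_submatrix_equiv_self] at hdet
  exact ⟨_, hdet⟩

/-! ### Rank-one perturbations of the Laplacian -/

section RankOne

variable [Fintype V] [DecidableEq V] [Fintype E] [CommRing R] [IsDomain R]

lemma det_laplacian_add_single (Γ : WeightedMultidigraph V E R) (v : V) :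
    (Γ.laplacian + Matrix.vecMulVec (Pi.single v 1) (Pi.single v 1)).det =
      Γ.arborescenceSum v := by
  have : Γ.laplacian + Matrix.vecMulVec (Pi.single v 1) (Pi.single v 1) =
      Γ.laplacian.updateRow v (Γ.laplacian v + Pi.single v 1) := by
    ext u w
    by_cases hu : u = v
    · subst hu
      simp [Matrix.vecMulVec_apply]
    · simp [Matrix.vecMulVec_apply, hu]
  have hV : Nonempty V := ⟨v⟩
  rw [this, Matrix.det_updateRow_add, Matrix.updateRow_eq_self, Γ.det_laplacian, zero_add,
    Γ.det_laplacian_updateRow_self]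

/-- Since `A` kills the Laplacian, `A N = (∑ c_w A_w) δ_v`. Multiplying by `N.adjugate` and reading
off coordinate `v` gives the formula times `A_v`, which cancels. -/
lemma det_laplacian_add_vecMulVec (Γ : WeightedMultidigraph V E R) {v : V}
    (hv : Γ.arborescenceSum v ≠ 0) (c : V → R) :
    (Γ.laplacian + Matrix.vecMulVec c (Pi.single v 1)).det = ∑ w, c w * Γ.arborescenceSum w := by
  set N := Γ.laplacian + Matrix.vecMulVec c (Pi.single v 1)
  have hrow : Matrix.vecMul Γ.arborescenceSum N =
      (∑ w, c w * Γ.arborescenceSum w) • Pi.single v 1 := by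
    rw [Matrix.vecMul_add, Γ.vecMul_arborescenceSum, zero_add, Matrix.vecMul_vecMulVec]
    simp [dotProduct, mul_comm]
  have hadj : N.adjugate v v = Γ.arborescenceSum v := by
    rw [Matrix.adjugate_apply, ← Γ.det_laplacian_updateRow_self v]
    -- Once row `v` is `δ_v`, the perturbation only adds multiples of that row to the others.
    refine Matrix.det_eq_of_forall_row_eq_smul_add_const (fun w => if w = v then 0 else c w) v
      (by simp) fun u w => ?_
    by_cases hu : u = v
    · subst hu
      simp
    · simp [hu, N, Matrix.vecMulVec_apply]
  have h := congrFun (congrArg (fun x => Matrix.vecMul x N.adjugate) hrow) v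
  simp only [Matrix.vecMul_vecMul, Matrix.mul_adjugate, Matrix.vecMul_smul, Matrix.vecMul_one,
    Matrix.smul_vecMul, Matrix.single_one_vecMul, Pi.smul_apply, Matrix.row_apply, hadj,
    smul_eq_mul] at h
  exact mul_right_cancel₀ hv h

end RankOne

/-! ### Laplacians and arborescence sums of a cover -/

namespace KFoldCover

variable {V' E' : Type*} {k : ℕ} {Γ' : WeightedMultidigraph V' E' R}
  {Γ : WeightedMultidigraph V E R}

lemma surjective_onV (π : KFoldCover k Γ' Γ) (v' : V') : Function.Surjective π.onV := by
  have hk : (k : ℕ∞) ≠ 0 := by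
    rw [← π.card_fiber_onV (π.onV v'), Set.encard_ne_zero]
    exact ⟨v', rfl⟩
  intro v
  rw [← π.card_fiber_onV v, Set.encard_ne_zero] at hk
  exact hk

variable [Fintype V] [DecidableEq V] [Fintype E] [Fintype V'] [DecidableEq V'] [Fintype E']

omit [Fintype V] [Fintype E] [DecidableEq V'] [Fintype E'] in
lemma card_filter_onV (π : KFoldCover k Γ' Γ) (v : V) :
    (Finset.univ.filter fun w => π.onV w = v).card = k := by
  have := π.card_fiber_onV v
  rw [← Finset.coe_filter_univ, Set.encard_coe_eq_coe_finsetCard] at this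
  exact_mod_cast this

variable [CommRing R]

omit [Fintype V] [Fintype V'] in
lemma sum_src_eq (π : KFoldCover k Γ' Γ) (w : V') (F : E → R) :
    ∑ e with Γ'.src e = w, F (π.onE e) = ∑ e with Γ.src e = π.onV w, F e := by
  have h := π.bijOn_out w
  refine Finset.sum_nbij π.onE (fun e he => ?_) ?_ ?_ fun _ _ => rfl
  · simpa using h.mapsTo (by simpa using he)
  · simpa using h.injOn
  · simpa using h.surjOn

omit [Fintype V] [Fintype V'] in
lemma sum_tgt_eq (π : KFoldCover k Γ' Γ) (w : V') (F : E → R) :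
    ∑ e with Γ'.tgt e = w, F (π.onE e) = ∑ e with Γ.tgt e = π.onV w, F e := by
  have h := π.bijOn_in w
  refine Finset.sum_nbij π.onE (fun e he => ?_) ?_ ?_ fun _ _ => rfl
  · simpa using h.mapsTo (by simpa using he)
  · simpa using h.injOn
  · simpa using h.surjOn

lemma laplacian_mulVec_comp (π : KFoldCover k Γ' Γ) (g : V → R) :
    Γ'.laplacian.mulVec (g ∘ π.onV) = Γ.laplacian.mulVec g ∘ π.onV := by
  ext w
  simp only [Function.comp_apply, laplacian_mulVec, π.wt_onE, ← π.tgt_onE]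
  exact π.sum_src_eq w fun e => Γ.wt e * (g (π.onV w) - g (Γ.tgt e))

lemma vecMul_laplacian_comp (π : KFoldCover k Γ' Γ) (a : V → R) :
    Matrix.vecMul (a ∘ π.onV) Γ'.laplacian = Matrix.vecMul a Γ.laplacian ∘ π.onV := by
  ext w
  simp only [Function.comp_apply, vecMul_laplacian, π.wt_onE, ← π.src_onE]
  rw [π.sum_src_eq w Γ.wt, π.sum_tgt_eq w fun e => Γ.wt e * a (Γ.src e)]

variable [IsDomain R]

lemma arborescenceSum_eq_of_onV_eq (π : KFoldCover k Γ' Γ) {w z : V'} (hwz : π.onV w = π.onV z)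
    (hz : Γ.arborescenceSum (π.onV z) ≠ 0) : Γ'.arborescenceSum w = Γ'.arborescenceSum z := by
  have hb : Matrix.vecMul (Γ.arborescenceSum ∘ π.onV) Γ'.laplacian = 0 := by
    rw [π.vecMul_laplacian_comp, Γ.vecMul_arborescenceSum]
    rfl
  have key : ∀ w z, π.onV w = π.onV z → Γ.arborescenceSum (π.onV z) ≠ 0 →
      Γ'.arborescenceSum z ≠ 0 → Γ'.arborescenceSum w = Γ'.arborescenceSum z := by
    intro w z hwz hz hne
    have h := adjugate_mul_eq_of_vecMul_eq_zero Γ'.vecMul_arborescenceSum hb (i := w) (j := z)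
      (l := z) (by rwa [Γ'.adjugate_laplacian])
    rw [Function.comp_apply, Function.comp_apply, hwz] at h
    exact (mul_right_cancel₀ hz h).symm
  by_cases hne : Γ'.arborescenceSum z = 0
  · by_contra hw
    -- If the sums differ and the one at `z` is zero, the one at `w` is nonzero, and `key` applies
    -- with the roles exchanged.
    exact hw (key z w hwz.symm (hwz ▸ hz) fun h => hw (h.trans hne.symm)).symm
  · exact key w z hwz hz hne

lemma arborescenceSum_dvd_sum_fiber (π : KFoldCover k Γ' Γ) {v' : V'}
    (hv' : Γ'.arborescenceSum v' ≠ 0) :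
    Γ.arborescenceSum (π.onV v') ∣ ∑ w with π.onV w = π.onV v', Γ'.arborescenceSum w := by
  set v := π.onV v' with hv
  have hdet := Γ'.det_laplacian_add_vecMulVec hv' ((Pi.single v 1 : V → R) ∘ π.onV)
  have hsum : ∑ w, ((Pi.single v 1 : V → R) ∘ π.onV) w * Γ'.arborescenceSum w =
      ∑ w with π.onV w = v, Γ'.arborescenceSum w := by
    rw [Finset.sum_filter]
    simp [Pi.single_apply]
  rw [← hsum, ← hdet, ← Γ.det_laplacian_add_single v]
  refine det_dvd_det_of_mulVec_comp (π.surjective_onV v') fun g => ?_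
  rw [Matrix.add_mulVec, Matrix.add_mulVec, π.laplacian_mulVec_comp, Matrix.vecMulVec_mulVec,
    Matrix.vecMulVec_mulVec]
  ext w
  simp [hv]

end KFoldCover

/-! ### Positivity, primitivity and degree of arborescence sums -/

section Evaluation

variable [Fintype E]

lemma exists_isArborescence_of_arborescenceSum_ne_zero [CommSemiring R]
    {Γ : WeightedMultidigraph V E R} {v : V} (h : Γ.arborescenceSum v ≠ 0) :
    ∃ T, Γ.IsArborescence v T := by
  classical
  obtain ⟨T, hT, -⟩ := Finset.exists_ne_zero_of_sum_ne_zero h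
  exact ⟨T, (Finset.mem_filter.1 hT).2⟩

open Classical in
lemma map_arborescenceSum_of_wt_eq_one [CommRing R] {Γ : WeightedMultidigraph V E R}
    (φ : R →+* ℤ) (hφ : ∀ e, φ (Γ.wt e) = 1) (v : V) :
    φ (Γ.arborescenceSum v) = (Finset.univ.filter (Γ.IsArborescence v)).card := by
  simp [arborescenceSum, map_sum, map_prod, hφ]

/-- No cancellation is possible: setting all weights to 1 turns each sum into a count of
arborescences. -/
lemma arborescenceSum_eq_zero_of_sum_eq_zero [CommRing R] {Γ : WeightedMultidigraph V E R}
    (φ : R →+* ℤ) (hφ : ∀ e, φ (Γ.wt e) = 1) {s : Finset V}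
    (hs : ∑ w ∈ s, Γ.arborescenceSum w = 0) {v : V} (hv : v ∈ s) :
    Γ.arborescenceSum v = 0 := by
  classical
  by_contra hne
  have h := congrArg φ hs
  simp only [map_sum, map_zero, map_arborescenceSum_of_wt_eq_one φ hφ] at h
  rw [Finset.sum_eq_zero_iff_of_nonneg fun _ _ => by positivity] at h
  obtain ⟨T, hT⟩ := exists_isArborescence_of_arborescenceSum_ne_zero hne
  have h0 := h v hv
  rw [Nat.cast_eq_zero, Finset.card_eq_zero] at h0
  exact absurd (Finset.mem_filter.2 ⟨Finset.mem_univ T, hT⟩) (h0 ▸ Finset.notMem_empty T)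

omit [Fintype E] in
lemma IsArborescence.eq_of_subset [Finite V] {Γ : WeightedMultidigraph V E R} {v : V}
    {S T : Finset E} (hS : Γ.IsArborescence v S) (hT : Γ.IsArborescence v T) (h : S ⊆ T) :
    S = T := by
  have := Fintype.ofFinite V
  exact Finset.eq_of_subset_of_card_le h
    (by have := hS.card_add_one; have := hT.card_add_one; omega)

open Classical in
-- Arborescences at `v` all have the same size, so only `T` survives the evaluation.
lemma eval_arborescenceSum_indicator [Finite V] {Γ : WeightedMultidigraph V E (MvPolynomial E ℤ)}
    (hwt : ∀ e, Γ.wt e = MvPolynomial.X e) {v : V} {T : Finset E} (hT : Γ.IsArborescence v T) :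
    MvPolynomial.eval (fun e => if e ∈ T then 1 else 0) (Γ.arborescenceSum v) = 1 := by
  simp only [arborescenceSum, map_sum, map_prod, hwt, MvPolynomial.eval_X]
  rw [Finset.sum_eq_single_of_mem T (by simpa using hT)]
  · exact Finset.prod_eq_one fun e he => if_pos he
  · intro S hS hne
    obtain ⟨e, heS, heT⟩ := Finset.not_subset.1 fun h =>
      hne ((Finset.mem_filter.1 hS).2.eq_of_subset hT h)
    exact Finset.prod_eq_zero heS (if_neg heT)

lemma isHomogeneous_arborescenceSum [Fintype V] {σ : Type*}
    {Γ : WeightedMultidigraph V E (MvPolynomial σ ℤ)} (hwt : ∀ e, (Γ.wt e).IsHomogeneous 1)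
    (v : V) : (Γ.arborescenceSum v).IsHomogeneous (Fintype.card V - 1) := by
  classical
  refine MvPolynomial.IsHomogeneous.sum _ _ _ fun T hT => ?_
  have hcard := (Finset.mem_filter.1 hT).2.card_add_one
  convert MvPolynomial.IsHomogeneous.prod T Γ.wt (fun _ => 1) fun e _ => hwt e
  rw [Finset.sum_const, smul_eq_mul, mul_one]
  omega

end Evaluation

end WeightedMultidigraph

/-! ### Polynomial divisibility and homogeneous quotients -/

namespace MvPolynomial

variable {σ : Type*}

/-- A divisor of a nonzero constant is a constant, and evaluation shows that it divides 1. -/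
lemma isRelPrime_C_of_eval_eq_one {n : ℤ} (hn : n ≠ 0) {q : MvPolynomial σ ℤ} {x : σ → ℤ}
    (hq : eval x q = 1) : IsRelPrime (C n) q := by
  intro d hdn hdq
  obtain ⟨m, -, rfl⟩ := (dvd_C_iff_exists hn).1 hdn
  have : m ∣ 1 := by simpa [hq] using map_dvd (eval x) hdq
  exact (isUnit_of_dvd_one this).map C

/-- Take the component of `P` in degree `n - m`; no cancellation of `q` is needed. -/
lemma exists_isHomogeneous_mul_eq {R : Type*} [CommSemiring R] {P q : MvPolynomial σ R} {m n : ℕ}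
    (hmn : m ≤ n) (hq : q.IsHomogeneous m) (hPq : (P * q).IsHomogeneous n) :
    ∃ P' : MvPolynomial σ R, P'.IsHomogeneous (n - m) ∧ P' * q = P * q := by
  let _ := gradedAlgebra (σ := σ) (R := R)
  refine ⟨DirectSum.decompose (homogeneousSubmodule σ R) P (n - m),
    (DirectSum.decompose (homogeneousSubmodule σ R) P (n - m)).2, ?_⟩
  rw [← DirectSum.coe_decompose_mul_add_of_right_mem (homogeneousSubmodule σ R) hq,
    Nat.sub_add_cancel hmn]
  exact DirectSum.decompose_of_mem_same _ hPq

end MvPolynomial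

theorem corollary1p5 {V E V' E' : Type*} [Finite V] [Fintype E] [Finite V'] [Fintype E']
    (Γ : WeightedMultidigraph V E (MvPolynomial E ℤ))
    (hwt : ∀ e, Γ.wt e = MvPolynomial.X e)
    (Γ' : WeightedMultidigraph V' E' (MvPolynomial E ℤ))
    (k : ℕ) (π : WeightedMultidigraph.KFoldCover k Γ' Γ)
    (v : V) (v' : V') (hv' : π.onV v' = v) :
    ∃ (P : MvPolynomial E ℤ) (d : ℕ), P.IsHomogeneous d ∧
      Γ'.arborescenceSum v' = P * Γ.arborescenceSum v ∧
      (Γ.arborescenceSum v ≠ 0 →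
        algebraMap (MvPolynomial E ℤ) (FractionRing (MvPolynomial E ℤ)) (Γ'.arborescenceSum v') /
          algebraMap (MvPolynomial E ℤ) (FractionRing (MvPolynomial E ℤ)) (Γ.arborescenceSum v) =
        algebraMap (MvPolynomial E ℤ) (FractionRing (MvPolynomial E ℤ)) P) := by
  classical
  have := Fintype.ofFinite V
  have := Fintype.ofFinite V'
  subst hv'
  suffices h : ∃ (P : MvPolynomial E ℤ) (d : ℕ), P.IsHomogeneous d ∧
      Γ'.arborescenceSum v' = P * Γ.arborescenceSum (π.onV v') by
    obtain ⟨P, d, hP, heq⟩ := h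
    refine ⟨P, d, hP, heq, fun hne => ?_⟩
    rw [heq, map_mul, mul_div_cancel_right₀]
    exact (map_ne_zero_iff _ (IsFractionRing.injective _ _)).2 hne
  by_cases hzero : Γ'.arborescenceSum v' = 0
  · exact ⟨0, 0, MvPolynomial.isHomogeneous_zero _ _ _, by rw [hzero, zero_mul]⟩
  have hwt' : ∀ e, Γ'.wt e = MvPolynomial.X (π.onE e) := fun e => by rw [π.wt_onE, hwt]
  obtain ⟨D, hD⟩ := π.arborescenceSum_dvd_sum_fiber hzero
  -- Otherwise the fibre sum would vanish by divisibility, hence each of its terms by positivity.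
  have hne : Γ.arborescenceSum (π.onV v') ≠ 0 := by
    intro h0
    rw [h0, zero_mul] at hD
    exact hzero (WeightedMultidigraph.arborescenceSum_eq_zero_of_sum_eq_zero
      (MvPolynomial.eval fun _ => 1) (by simp [hwt']) hD (by simp))
  have hkD : MvPolynomial.C (k : ℤ) * Γ'.arborescenceSum v' =
      Γ.arborescenceSum (π.onV v') * D := by
    rw [← hD, Finset.sum_congr rfl fun w hw =>
      π.arborescenceSum_eq_of_onV_eq (Finset.mem_filter.1 hw).2 hne, Finset.sum_const,
      π.card_filter_onV, nsmul_eq_mul, ← map_natCast MvPolynomial.C]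
  have hk : (k : ℤ) ≠ 0 := by
    have h := Finset.card_ne_zero_of_mem (s := {w | π.onV w = π.onV v'})
      (Finset.mem_filter.2 ⟨Finset.mem_univ v', rfl⟩)
    rw [π.card_filter_onV] at h
    exact_mod_cast h
  obtain ⟨T, hT⟩ := WeightedMultidigraph.exists_isArborescence_of_arborescenceSum_ne_zero hne
  -- `k` divides `A_v D` and is relatively prime to `A_v`, so it divides `D`.
  obtain ⟨P, rfl⟩ := (MvPolynomial.isRelPrime_C_of_eval_eq_one hk
    (WeightedMultidigraph.eval_arborescenceSum_indicator hwt hT)).dvd_of_dvd_mul_left ⟨_, hkD.symm⟩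
  have heq : Γ'.arborescenceSum v' = P * Γ.arborescenceSum (π.onV v') :=
    mul_left_cancel₀ ((map_ne_zero_iff _ (MvPolynomial.C_injective E ℤ)).2 hk)
      (by rw [hkD]; ring)
  have hhom' := WeightedMultidigraph.isHomogeneous_arborescenceSum
    (fun e => hwt' e ▸ MvPolynomial.isHomogeneous_X ℤ (π.onE e)) v'
  have hhom := WeightedMultidigraph.isHomogeneous_arborescenceSum
    (fun e => hwt e ▸ MvPolynomial.isHomogeneous_X ℤ e) (π.onV v')
  rw [heq] at hhom' ⊢
  obtain ⟨P', hP', hmul⟩ := MvPolynomial.exists_isHomogeneous_mul_eq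
    (Nat.sub_le_sub_right (Fintype.card_le_of_surjective _ (π.surjective_onV v')) 1) hhom hhom'
  exact ⟨P', _, hP', hmul.symm⟩
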